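/- Let $G$ be a group with a finite symmetric generating set $S$, acting measurably on a standard probability space $(X,\mu)$. Assume that the action preserves $\mu$ and is essentially free, i.e. $\mu(\{x\in X : gx=x\})=0$ for every $g\in G$ with $g\neq e$. Let $\theta=\{(x,y)\in X\times X : y\in Gx\}$ be the orbit equivalence relation, and for $n\ge 1$ define the isoperimetric profile of the action by \[ \mathcal I_{G\curvearrowright X}(n)=\inf_{\theta'}\ \mu\bigl(\{x\in X : sx\notin[x]_{\theta'}\text{ for some }s\in S\}\bigr), \] where the infimum is over all equivalence relations $\theta'\subseteq\theta$ on $X$ that are measurable as subsets of $X\times X$ and all of whose classes $[x]_{\theta'}$ have at most $n$ elements. Call $G$ amenable if for every finite set $E\subseteq G$ and every $\varepsilon>0$ there is a nonempty finite set $F\subseteq G$ with $|gF\,\triangle\,F|\le\varepsilon|F|$ for all $g\in E$. If $\mathcal I_{G\curvearrowright X}(n)\to 0$ as $n\to\infty$, then $G$ is amenable. Conversely, if $G$ is amenable and the action is also ergodic, then $\mathcal I_{G\curvearrowright X}(n)\to 0$ as $n\to\infty$. -/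

import Mathlib

open MeasureTheory Filter Topology
open scoped ENNReal

/-- Amenability of a discrete group, through the Følner condition. -/
def AmenableGroup (G : Type*) [Group G] : Prop :=
  open scoped Classical Pointwise in
  ∀ (E : Finset G) (ε : ℝ), 0 < ε →
    ∃ F : Finset G, F.Nonempty ∧
      ∀ g ∈ E, ((symmDiff (g • F) F).card : ℝ) ≤ ε * (F.card : ℝ)

/-- The action of `G` on `(X, μ)` is essentially free: every nontrivial element of `G` has
a null set of fixed points. -/
def EssentiallyFree (G : Type*) {X : Type*} [Group G] [MulAction G X] [MeasurableSpace X]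
    (μ : Measure X) : Prop :=
  ∀ g : G, g ≠ 1 → μ (MulAction.fixedBy X g) = 0

/-- `r` is a measurable subequivalence relation of the orbit equivalence relation of `G` on `X`
all of whose classes have at most `n` elements. -/
structure IsBoundedSubrelation (G : Type*) {X : Type*} [Group G] [MulAction G X]
    [MeasurableSpace X] (n : ℕ) (r : Setoid X) : Prop where
  le_orbitRel : r ≤ MulAction.orbitRel G X
  measurableSet : MeasurableSet {p : X × X | r p.1 p.2}
  encard_le : ∀ x : X, {y : X | r x y}.encard ≤ n

/-- The boundary of `r` with respect to `S`: the points `x` that some `s ∈ S` moves out of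
their `r`-class. -/
def relBoundary {G X : Type*} [Group G] [MulAction G X] (S : Set G) (r : Setoid X) : Set X :=
  {x : X | ∃ s ∈ S, ¬ r x (s • x)}

/-- The isoperimetric profile of the action of `(G, S)` on `(X, μ)`. It is valued in `ℝ≥0∞`; for
`n ≥ 1` and `μ` a probability measure on a standard Borel space it is at most `1`, and for `n = 0`
the infimum is over the empty family. -/
noncomputable def actionProfile {G X : Type*} [Group G] [MulAction G X] [MeasurableSpace X]
    (S : Set G) (μ : Measure X) (n : ℕ) : ℝ≥0∞ :=
  ⨅ (r : Setoid X) (_ : IsBoundedSubrelation G n r), μ (relBoundary S r)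

/-! Small profile gives amenability by mass transport. Let `r` be a bounded subrelation whose
boundary `D` has measure at most `δ`. Invariance of `μ` bounds the average over `x` of the
proportion of the class of `x` lying in `D` by `μ D` (`lintegral_share_le`). Hence some `x` with
trivial stabilizer has proportion at most `δ`. Its class pulls back along the injective map `g ↦ g •
x` to a finite `F ⊆ G`, and every `f ∈ F` that a generator moves out of `F` has `f • x ∈ D`. So `F`
is almost invariant under `S`, and bounded word length carries this to any given finite set of
elements.

The converse is an exhaustion. A partial tiling has finite classes inside a domain `B`, and its cut
edges touching `B` cost at most `ε * μ B`. If `A = Bᶜ` is not null, averaging a Følner set `F` over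
base points finds tiles `F • c` whose traces on `A` have few exits, and freeness makes them disjoint
(`exists_tile_base`). Adding these traces as classes preserves the cost bound, because edges between
`A` and `B` are already paid for. A tiling with `μ B` maximal among its extensions therefore has
full measure. Breaking its large classes into points bounds the class size, at a cost that tends to
zero. -/

/-! ### Displacement of finite sets in a group. -/

section Group

variable {G : Type*} [Group G]

/-- A group generated by a finite set is countable. -/
theorem countable_of_closure_eq_top {S : Set G} (hSfin : S.Finite)
    (hSgen : Subgroup.closure S = ⊤) : Countable G := by
  have : Countable S := hSfin.countable.to_subtype
  have : Countable (FreeGroup S) := by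
    unfold FreeGroup
    infer_instance
  have hsurj : Function.Surjective (FreeGroup.lift ((↑) : S → G)) := by
    rw [← MonoidHom.range_eq_top, FreeGroup.range_lift_eq_closure, Subtype.range_coe, hSgen]
  exact hsurj.countable

open scoped Classical Pointwise in
/-- Every group element is a bounded word in the generators, so a set that the generators displace
little is displaced little by any given element. -/
theorem exists_card_symmDiff_smul_le {S : Set G} (hSgen : Subgroup.closure S = ⊤) (g : G) :
    ∃ L : ℕ, ∀ (F : Finset G) (c : ℝ), 0 ≤ c →
      (∀ s ∈ S, ((symmDiff (s • F) F).card : ℝ) ≤ c) →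
        ((symmDiff (g • F) F).card : ℝ) ≤ L * c := by
  have hg : g ∈ Subgroup.closure S := hSgen ▸ Subgroup.mem_top g
  induction hg using Subgroup.closure_induction with
  | mem s hs => exact ⟨1, fun F c _ h => by simpa using h s hs⟩
  | one => exact ⟨0, fun F c _ _ => by simp⟩
  | mul a b _ _ iha ihb =>
    obtain ⟨L, hL⟩ := iha
    obtain ⟨M, hM⟩ := ihb
    refine ⟨L + M, fun F c hc h => ?_⟩
    have h1 : (symmDiff ((a * b) • F) F).card
        ≤ (symmDiff (a • F) F).card + (symmDiff (b • F) F).card := by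
      have h2 : symmDiff ((a * b) • F) F
          ⊆ symmDiff ((a * b) • F) (a • F) ∪ symmDiff (a • F) F := symmDiff_triangle _ _ _
      have h3 : symmDiff ((a * b) • F) (a • F) = a • symmDiff (b • F) F := by
        rw [mul_smul, Finset.smul_finset_symmDiff]
      have h4 := (Finset.card_le_card h2).trans (Finset.card_union_le _ _)
      rw [h3, Finset.card_smul_finset] at h4
      omega
    have h5 : ((symmDiff ((a * b) • F) F).card : ℝ)
        ≤ (symmDiff (a • F) F).card + (symmDiff (b • F) F).card := by exact_mod_cast h1
    push_cast
    linarith [hL F c hc h, hM F c hc h]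
  | inv a _ iha =>
    obtain ⟨L, hL⟩ := iha
    refine ⟨L, fun F c hc h => ?_⟩
    have h3 : symmDiff (a⁻¹ • F) F = a⁻¹ • symmDiff (a • F) F := by
      rw [Finset.smul_finset_symmDiff, inv_smul_smul, symmDiff_comm]
    rw [h3, Finset.card_smul_finset]
    exact hL F c hc h

open scoped Classical Pointwise in
/-- The displacement of a finite set by `g` is twice the number of its points that `g` moves out. -/
theorem card_symmDiff_smul_eq (g : G) (F : Finset G) :
    (symmDiff (g • F) F).card = 2 * (F.filter fun f => g * f ∉ F).card := by
  have h1 : (g • F) \ F = g • (F.filter fun f => g * f ∉ F) := by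
    ext x
    simp only [Finset.mem_sdiff, Finset.mem_smul_finset, Finset.mem_filter, smul_eq_mul]
    constructor
    · rintro ⟨⟨y, hy, rfl⟩, h⟩
      exact ⟨y, ⟨hy, h⟩, rfl⟩
    · rintro ⟨y, ⟨hy, h⟩, rfl⟩
      exact ⟨⟨y, hy, rfl⟩, h⟩
  have h2 : ((g • F) \ F).card = (F \ (g • F)).card :=
    Finset.card_sdiff_comm (Finset.card_smul_finset g F)
  have h3 : (symmDiff (g • F) F).card = ((g • F) \ F).card + (F \ (g • F)).card := by
    rw [symmDiff_def, Finset.sup_eq_union, Finset.card_union_of_disjoint disjoint_sdiff_sdiff]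
  rw [h3, ← h2, h1, Finset.card_smul_finset]
  ring

end Group

/-! ### Mass transport: from small boundary to Følner sets. -/

section MassTransport

variable {G X : Type*} [Group G] [MulAction G X]

open scoped Classical in
/-- The number of group elements that keep `x` in its class; for a point with trivial stabilizer
this is the size of the class. -/
noncomputable def returnCount (G : Type*) {X : Type*} [Group G] [MulAction G X] (r : Setoid X)
    (x : X) : ℝ≥0∞ :=
  ∑' g : G, if r x (g • x) then 1 else 0

-- Right multiplication by `g` matches the return elements of `g • x` with those of `x`. The
-- normalizing weight is thus the same at both ends of a transport, even without freeness.
open scoped Classical in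
theorem returnCount_smul {r : Setoid X} {x : X} {g : G} (h : r x (g • x)) :
    returnCount G r (g • x) = returnCount G r x := by
  unfold returnCount
  rw [← (Equiv.mulRight g).tsum_eq fun k : G => if r x (k • x) then (1 : ℝ≥0∞) else 0]
  refine tsum_congr fun k => ?_
  have : r (g • x) (k • g • x) ↔ r x (k • g • x) :=
    ⟨fun h' => r.trans' h h', fun h' => r.trans' (r.symm' h) h'⟩
  simp [mul_smul, this]

variable [MeasurableSpace X]

theorem measurableSet_rel_smul [MeasurableConstSMul G X] {r : Setoid X}
    (hr : MeasurableSet {p : X × X | r p.1 p.2}) (g : G) : MeasurableSet {x : X | r x (g • x)} :=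
  (measurable_id.prodMk (measurable_const_smul g)) hr

theorem measurableSet_relBoundary [MeasurableConstSMul G X] {r : Setoid X}
    (hr : MeasurableSet {p : X × X | r p.1 p.2}) {S : Set G} (hS : S.Countable) :
    MeasurableSet (relBoundary S r) := by
  have h : relBoundary S r = ⋃ s ∈ S, {x : X | r x (s • x)}ᶜ := by
    ext x
    simp [relBoundary]
  rw [h]
  exact .biUnion hS fun s _ => (measurableSet_rel_smul hr s).compl

open scoped Classical in
/-- Mass transport: averaging the share of a set in the class of `x` over all `x` gives at most the
measure of the set. -/
theorem lintegral_share_le [Countable G] [MeasurableConstSMul G X] (μ : Measure X)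
    [SMulInvariantMeasure G X μ] {r : Setoid X} (hr : MeasurableSet {p : X × X | r p.1 p.2})
    {D : Set X} (hD : MeasurableSet D) :
    ∫⁻ x, (∑' g : G, if r x (g • x) ∧ g • x ∈ D then 1 else 0) * (returnCount G r x)⁻¹ ∂μ
      ≤ μ D := by
  have hN : Measurable (returnCount G r) :=
    Measurable.tsum fun g =>
      Measurable.ite (measurableSet_rel_smul hr g) measurable_const measurable_const
  -- The mass that `y` receives from `g⁻¹ • y`; invariance of `μ` allows the substitution `y = g •
  -- x`.
  set φ : G → X → ℝ≥0∞ := fun g y =>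
    (if r y (g⁻¹ • y) ∧ y ∈ D then 1 else 0) * (returnCount G r y)⁻¹ with hφ
  have hφm : ∀ g, Measurable (φ g) := fun g =>
    (Measurable.ite ((measurableSet_rel_smul hr _).inter hD) measurable_const
      measurable_const).mul hN.inv
  have h1 : ∀ x, (∑' g : G, if r x (g • x) ∧ g • x ∈ D then 1 else 0) * (returnCount G r x)⁻¹
      = ∑' g : G, φ g (g • x) := by
    intro x
    rw [← ENNReal.tsum_mul_right]
    refine tsum_congr fun g => ?_
    simp only [hφ, inv_smul_smul]
    by_cases h : r x (g • x)
    · rw [returnCount_smul h]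
      simp [h, r.symm' h]
    · have h' : ¬ r (g • x) x := fun h' => h (r.symm' h')
      simp [h, h']
  calc ∫⁻ x, (∑' g : G, if r x (g • x) ∧ g • x ∈ D then 1 else 0) * (returnCount G r x)⁻¹ ∂μ
      = ∫⁻ x, ∑' g : G, φ g (g • x) ∂μ := by simp_rw [h1]
    _ = ∑' g : G, ∫⁻ x, φ g (g • x) ∂μ :=
        lintegral_tsum fun g => ((hφm g).comp (measurable_const_smul g)).aemeasurable
    _ = ∑' g : G, ∫⁻ y, φ g y ∂μ :=
        tsum_congr fun g => (measurePreserving_smul g μ).lintegral_comp (hφm g)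
    _ = ∫⁻ y, ∑' g : G, φ g y ∂μ := (lintegral_tsum fun g => (hφm g).aemeasurable).symm
    -- Only an inequality: where the return count is infinite, its product with its inverse is `0`.
    _ ≤ ∫⁻ y, D.indicator 1 y ∂μ := by
        refine lintegral_mono fun y => ?_
        simp only [hφ]
        rw [ENNReal.tsum_mul_right]
        by_cases hy : y ∈ D
        · have : (∑' g : G, if r y (g⁻¹ • y) ∧ y ∈ D then (1 : ℝ≥0∞) else 0)
              = returnCount G r y := by
            unfold returnCount
            rw [← (Equiv.inv G).tsum_eq fun k : G => if r y (k • y) then (1 : ℝ≥0∞) else 0]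
            simp [hy]
          rw [this]
          simp [hy, ENNReal.mul_inv_le_one]
        · simp [hy]
    _ = μ D := lintegral_indicator_one hD

open scoped Classical Pointwise in
/-- A bounded subrelation with small boundary yields a finite set that the generators displace
little. -/
theorem exists_finset_card_symmDiff_le [Countable G] [MeasurableConstSMul G X]
    {S : Set G} (hS : S.Countable) (μ : Measure X) [IsProbabilityMeasure μ]
    [SMulInvariantMeasure G X μ] (hfree : EssentiallyFree G μ) {n : ℕ} {r : Setoid X}
    (hr : IsBoundedSubrelation G n r) {δ : ℝ} (hδ : 0 ≤ δ)
    (hb : μ (relBoundary S r) ≤ ENNReal.ofReal δ) :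
    ∃ F : Finset G, F.Nonempty ∧
      ∀ s ∈ S, ((symmDiff (s • F) F).card : ℝ) ≤ 2 * δ * F.card := by
  have hD : MeasurableSet (relBoundary S r) := measurableSet_relBoundary hr.measurableSet hS
  have hnull : μ (⋃ g ∈ {g : G | g ≠ 1}, MulAction.fixedBy X g) = 0 :=
    (measure_biUnion_null_iff (Set.to_countable _)).2 fun g hg => hfree g hg
  have hmeas : Measurable fun x =>
      (∑' g : G, if r x (g • x) ∧ g • x ∈ relBoundary S r then (1 : ℝ≥0∞) else 0)
        * (returnCount G r x)⁻¹ := by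
    refine Measurable.mul (Measurable.tsum fun g => ?_) (Measurable.inv (Measurable.tsum fun g => ?_))
    · exact Measurable.ite ((measurableSet_rel_smul hr.measurableSet g).inter
        (measurable_const_smul g hD)) measurable_const measurable_const
    · exact Measurable.ite (measurableSet_rel_smul hr.measurableSet g) measurable_const
        measurable_const
  -- A point off all the fixed-point sets whose boundary share is at most the average.
  obtain ⟨x, hx, hle⟩ := exists_notMem_null_le_lintegral hmeas.aemeasurable hnull
  replace hle := (hle.trans (lintegral_share_le μ hr.measurableSet hD)).trans hb
  have hinj : Function.Injective fun g : G => g • x := by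
    intro g h hgh
    by_contra hne
    refine hx (Set.mem_biUnion (x := h⁻¹ * g) ?_ ?_)
    · intro h1
      exact hne (inv_mul_eq_one.1 h1).symm
    · simp only at hgh
      rw [MulAction.mem_fixedBy, mul_smul, hgh, inv_smul_smul]
  have hfin : {g : G | r x (g • x)}.Finite :=
    (Set.finite_of_encard_le_coe (hr.encard_le x)).preimage (f := fun g : G => g • x) hinj.injOn
  set F : Finset G := hfin.toFinset with hF
  have hmem : ∀ g, g ∈ F ↔ r x (g • x) := fun g => by simp [hF]
  have h1F : (1 : G) ∈ F := (hmem 1).2 (by rw [one_smul])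
  have hN : returnCount G r x = F.card := by
    unfold returnCount
    rw [tsum_eq_sum (s := F) fun g hg => if_neg fun h => hg ((hmem g).2 h), Finset.sum_congr rfl
      fun g hg => if_pos ((hmem g).1 hg)]
    simp
  have hcount : (∑' g : G, if r x (g • x) ∧ g • x ∈ relBoundary S r then (1 : ℝ≥0∞) else 0)
      = (F.filter fun g => g • x ∈ relBoundary S r).card := by
    rw [tsum_eq_sum (s := F) fun g hg => if_neg fun h => hg ((hmem g).2 h.1), Finset.sum_congr rfl
      fun g hg => if_congr (and_iff_right ((hmem g).1 hg)) rfl rfl]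
    simp
  have hFpos : F.card ≠ 0 := Finset.card_ne_zero_of_mem h1F
  rw [hN, hcount, ← div_eq_mul_inv, ENNReal.div_le_iff (by exact_mod_cast hFpos)
    (ENNReal.natCast_ne_top _), ← ENNReal.ofReal_natCast, ← ENNReal.ofReal_natCast,
    ← ENNReal.ofReal_mul hδ, ENNReal.ofReal_le_ofReal_iff (by positivity)] at hle
  refine ⟨F, ⟨1, h1F⟩, fun s hs => ?_⟩
  -- If `f ∈ F` but `s * f ∉ F`, then `s` moves `f • x` out of the class of `x`.
  have hsub : (F.filter fun f => s * f ∉ F) ⊆ F.filter fun g => g • x ∈ relBoundary S r := by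
    intro f hf
    rw [Finset.mem_filter, hmem, hmem] at hf
    rw [Finset.mem_filter, hmem]
    refine ⟨hf.1, s, hs, fun h => hf.2 ?_⟩
    rw [mul_smul]
    exact r.trans' hf.1 h
  rw [card_symmDiff_smul_eq]
  have h2 : ((F.filter fun f => s * f ∉ F).card : ℝ)
      ≤ (F.filter fun g => g • x ∈ relBoundary S r).card := by
    exact_mod_cast Finset.card_le_card hsub
  push_cast
  linarith

/-- An essentially free action whose isoperimetric profile tends to zero comes from an amenable
group. -/
theorem amenableGroup_of_tendsto_actionProfile [MeasurableConstSMul G X]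
    {S : Set G} (hSfin : S.Finite) (hSgen : Subgroup.closure S = ⊤)
    (μ : Measure X) [IsProbabilityMeasure μ] [SMulInvariantMeasure G X μ]
    (hfree : EssentiallyFree G μ)
    (h : Tendsto (fun n : ℕ => actionProfile S μ n) atTop (𝓝 0)) : AmenableGroup G := by
  have := countable_of_closure_eq_top hSfin hSgen
  intro E ε hε
  choose L hL using exists_card_symmDiff_smul_le (G := G) hSgen
  set M : ℕ := E.sup L with hM
  -- Chosen so that `L g * (2 * δ) ≤ ε` for all `g ∈ E`; the `+ 1` keeps the denominator positive.
  set δ : ℝ := ε / (2 * (M + 1)) with hδ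
  have hδpos : 0 < δ := by positivity
  obtain ⟨n, hn⟩ := (h.eventually_lt_const (ENNReal.ofReal_pos.2 hδpos)).exists
  simp only [actionProfile, iInf_lt_iff] at hn
  obtain ⟨r, hr, hb⟩ := hn
  obtain ⟨F, hF, hFS⟩ := exists_finset_card_symmDiff_le hSfin.countable μ hfree hr hδpos.le hb.le
  refine ⟨F, hF, fun g hg => (hL g F _ (by positivity) hFS).trans ?_⟩
  have h1 : (L g : ℝ) ≤ M + 1 := by
    have : L g ≤ M := Finset.le_sup hg
    exact_mod_cast this.trans (Nat.le_succ M)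
  calc (L g : ℝ) * (2 * δ * F.card) ≤ (M + 1) * (2 * δ * F.card) := by gcongr
    _ = ε * F.card := by
      rw [hδ]
      field_simp

end MassTransport

/-! ### Exhaustion along sequences. -/

/-- An ordering principle: if every increasing sequence has an upper bound, a bounded monotone real
function cannot grow beyond some point. -/
theorem exists_forall_rel_le {α : Type*} [Nonempty α] (R : α → α → Prop) (hrefl : ∀ a, R a a)
    (htrans : ∀ a b c, R a b → R b c → R a c) (f : α → ℝ) (hmono : ∀ a b, R a b → f a ≤ f b)
    (hbdd : BddAbove (Set.range f))
    (hseq : ∀ u : ℕ → α, (∀ n, R (u n) (u (n + 1))) → ∃ b, ∀ n, R (u n) b) :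
    ∃ b, ∀ c, R b c → f c ≤ f b := by
  -- Greedy choice: above `a`, come within `1 / (n + 1)` of the supremum of what is still reachable.
  -- Anything above a bound of the resulting sequence then gains less than every such error.
  have hstep : ∀ (n : ℕ) (a : α), ∃ b, R a b ∧ ∀ c, R a c → f c ≤ f b + 1 / ((n : ℝ) + 1) := by
    intro n a
    have hne : (f '' {c | R a c}).Nonempty := ⟨f a, a, hrefl a, rfl⟩
    have hb : BddAbove (f '' {c | R a c}) := hbdd.mono (Set.image_subset_range _ _)
    have hpos : (0 : ℝ) < 1 / ((n : ℝ) + 1) := by positivity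
    obtain ⟨_, ⟨b, hab, rfl⟩, hlt⟩ := exists_lt_of_lt_csSup hne
      (sub_lt_self (sSup (f '' {c | R a c})) hpos)
    refine ⟨b, hab, fun c hc => ?_⟩
    linarith [le_csSup hb ⟨c, hc, rfl⟩]
  choose next hnext hle using hstep
  set u : ℕ → α := fun n => Nat.rec (Classical.arbitrary α) next n with hu
  have hu1 : ∀ n, u (n + 1) = next n (u n) := fun n => rfl
  obtain ⟨b, hb⟩ := hseq u fun n => by rw [hu1]; exact hnext n _
  refine ⟨b, fun c hc => ?_⟩
  refine le_of_forall_pos_le_add fun δ hδ => ?_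
  obtain ⟨n, hn⟩ := exists_nat_one_div_lt hδ
  have h1 := hle n (u n) c (htrans _ _ _ (hb n) hc)
  have h2 := hmono _ _ (hb (n + 1))
  rw [hu1] at h2
  linarith

/-! ### Partial tilings and their increasing limits. -/

section Tiling

variable {G X : Type*} [Group G] [MulAction G X] [MeasurableSpace X]

/-- In an essentially free action, every non-null set contains a non-null piece that is moved off
itself by each of finitely many given nontrivial elements. -/
theorem exists_subset_forall_smul_notMem [StandardBorelSpace X] [MeasurableConstSMul G X]
    {μ : Measure X} (hfree : EssentiallyFree G μ) (D : Finset G) (hD : (1 : G) ∉ D) {P : Set X}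
    (hP : MeasurableSet P) (hP0 : μ P ≠ 0) :
    ∃ C ⊆ P, MeasurableSet C ∧ μ C ≠ 0 ∧ ∀ g ∈ D, ∀ x ∈ C, g • x ∉ C := by
  classical
  induction D using Finset.induction_on with
  | empty => exact ⟨P, subset_rfl, hP, hP0, by simp⟩
  | insert g D hgD ih =>
    obtain ⟨C, hCP, hC, hC0, hCD⟩ := ih fun h => hD (Finset.mem_insert_of_mem h)
    have hg : g ≠ 1 := fun h => hD (h ▸ Finset.mem_insert_self _ _)
    -- Countably many measurable sets separate points, so each point moved by `g` is separated from
    -- its image by some `U n`. As the fixed points are null, one `U n` or its complement does this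
    -- on a non-null part of `C`.
    obtain ⟨U, hU, hsep⟩ := exists_seq_separating (α := X) MeasurableSet.univ Set.univ
    have key : ∃ V : Set X, MeasurableSet V ∧ μ (C ∩ V ∩ (g • ·) ⁻¹' Vᶜ) ≠ 0 := by
      by_contra! hcon
      have h1 : C ⊆ MulAction.fixedBy X g ∪ ⋃ n, ((C ∩ U n ∩ (g • ·) ⁻¹' (U n)ᶜ) ∪
          (C ∩ (U n)ᶜ ∩ (g • ·) ⁻¹' (U n)ᶜᶜ)) := by
        intro x hx
        by_cases hfix : g • x = x
        · exact Or.inl hfix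
        · right
          have : ∃ n, ¬ (x ∈ U n ↔ g • x ∈ U n) := by
            by_contra! hall
            exact hfix (hsep x trivial (g • x) trivial hall).symm
          obtain ⟨n, hn⟩ := this
          refine Set.mem_iUnion.2 ⟨n, ?_⟩
          by_cases hxn : x ∈ U n
          · exact Or.inl ⟨⟨hx, hxn⟩, fun h => hn ⟨fun _ => h, fun _ => hxn⟩⟩
          · refine Or.inr ⟨⟨hx, hxn⟩, fun h => hn ⟨fun h' => absurd h' hxn, fun h' => absurd h' h⟩⟩
      refine hC0 (measure_mono_null h1 (measure_union_null (hfree g hg) ?_))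
      exact measure_iUnion_null fun n => measure_union_null (hcon _ (hU n)) (hcon _ (hU n).compl)
    obtain ⟨V, hV, hV0⟩ := key
    refine ⟨C ∩ V ∩ (g • ·) ⁻¹' Vᶜ, fun x hx => hCP hx.1.1,
      (hC.inter hV).inter (measurable_const_smul g hV.compl), hV0, fun k hk x hx hkx => ?_⟩
    rcases Finset.mem_insert.1 hk with rfl | hk
    · exact hx.2 hkx.1.2
    · exact hCD k hk x hx.1.1 hkx.1.1

/-- `r` is a measurable subrelation of the orbit relation with finite classes, trivial off the
measurable set `B`, such that the edges from the generators in `S` that touch `B` and join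
different classes have total measure at most `ε * μ B`. -/
structure IsPartialTiling (S : Finset G) (μ : Measure X) (ε : ℝ≥0∞) (r : Setoid X) (B : Set X) :
    Prop where
  le_orbitRel : r ≤ MulAction.orbitRel G X
  measurableSet_rel : MeasurableSet {p : X × X | r p.1 p.2}
  finite_class : ∀ x, {y | r x y}.Finite
  measurableSet : MeasurableSet B
  eq_of_notMem : ∀ x y, x ∉ B → r x y → x = y
  cut_le : ∑ s ∈ S, μ {x | (x ∈ B ∨ s • x ∈ B) ∧ ¬ r x (s • x)} ≤ ε * μ B

/-- One partial tiling extends another if it has the same classes on the smaller domain. -/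
def TilingExtends (p q : Setoid X × Set X) : Prop :=
  p.2 ⊆ q.2 ∧ ∀ x ∈ p.2, ∀ y, q.1 x y ↔ p.1 x y

namespace IsPartialTiling

variable {S : Finset G} {μ : Measure X} {ε : ℝ≥0∞} {r : Setoid X} {B : Set X}

theorem bot [StandardBorelSpace X] : IsPartialTiling S μ ε (⊥ : Setoid X) ∅ where
  le_orbitRel := bot_le
  measurableSet_rel := by
    simpa [Setoid.bot_def] using measurableSet_eq_fun (measurable_fst (α := X) (β := X)) measurable_snd
  finite_class x := by
    simp only [Setoid.bot_def, Set.ofPred_eq_eq_singleton']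
    exact Set.finite_singleton x
  measurableSet := .empty
  eq_of_notMem x y _ h := h
  cut_le := by simp

/-- Increasing sequences of partial tilings have upper bounds. -/
theorem exists_extends_seq (r : ℕ → Setoid X) (B : ℕ → Set X)
    (h : ∀ n, IsPartialTiling S μ ε (r n) (B n))
    (hext : ∀ n, TilingExtends (r n, B n) (r (n + 1), B (n + 1))) :
    ∃ r' B', IsPartialTiling S μ ε r' B' ∧ ∀ n, TilingExtends (r n, B n) (r', B') := by
  have hext' : ∀ m n, m ≤ n → TilingExtends (r m, B m) (r n, B n) := by
    intro m n hmn
    induction n, hmn using Nat.le_induction with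
    | base => exact ⟨subset_rfl, fun x _ y => Iff.rfl⟩
    | succ n hmn ih =>
      exact ⟨ih.1.trans (hext n).1, fun x hx y =>
        ((hext n).2 x (ih.1 hx) y).trans (ih.2 x hx y)⟩
  -- Since `r m` is trivial off `B m`, extension gives genuine inclusion of relations; this makes
  -- the union transitive.
  have hle : ∀ m n, m ≤ n → ∀ x y, r m x y → r n x y := by
    intro m n hmn x y hxy
    by_cases hx : x ∈ B m
    · exact ((hext' m n hmn).2 x hx y).2 hxy
    · rw [(h m).eq_of_notMem x y hx hxy]
  let r' : Setoid X :=
    { r := fun x y => ∃ n, r n x y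
      iseqv :=
        { refl := fun x => ⟨0, (r 0).refl' x⟩
          symm := fun ⟨n, hn⟩ => ⟨n, (r n).symm' hn⟩
          trans := fun ⟨m, hm⟩ ⟨n, hn⟩ => ⟨max m n, (r _).trans'
            (hle m _ (le_max_left _ _) _ _ hm) (hle n _ (le_max_right _ _) _ _ hn)⟩ } }
  have hr' : ∀ n, ∀ x ∈ B n, ∀ y, r' x y ↔ r n x y := by
    refine fun n x hx y => ⟨fun ⟨m, hm⟩ => ?_, fun hn => ⟨n, hn⟩⟩
    exact ((hext' n _ (le_max_right m n)).2 x hx y).1 (hle m _ (le_max_left m n) _ _ hm)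
  have hBmono : Monotone B := fun m n hmn => (hext' m n hmn).1
  refine ⟨r', ⋃ n, B n, ?_, fun n => ⟨Set.subset_iUnion B n, hr' n⟩⟩
  refine ⟨?_, ?_, ?_, .iUnion fun n => (h n).measurableSet, ?_, ?_⟩
  · rintro x y ⟨n, hn⟩
    exact (h n).le_orbitRel hn
  · have : {p : X × X | r' p.1 p.2} = ⋃ n, {p : X × X | r n p.1 p.2} := by
      ext p
      simp only [Set.mem_ofPred_eq, Set.mem_iUnion]
      rfl
    rw [this]
    exact .iUnion fun n => (h n).measurableSet_rel
  · intro x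
    by_cases hx : ∃ n, x ∈ B n
    · obtain ⟨n, hn⟩ := hx
      exact ((h n).finite_class x).subset fun y hy => (hr' n x hn y).1 hy
    · refine (Set.finite_singleton x).subset ?_
      rintro y ⟨n, hn⟩
      exact ((h n).eq_of_notMem x y (fun hx' => hx ⟨n, hx'⟩) hn).symm
  · rintro x y hx ⟨n, hn⟩
    exact (h n).eq_of_notMem x y (fun hx' => hx (Set.mem_iUnion.2 ⟨n, hx'⟩)) hn
  -- Classes meeting `B n` are frozen from stage `n` on, so later stages do not change the cut edges
  -- touching `B n`. Continuity of `μ` from below passes the bound to the limit.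
  · have hcut : ∀ (n : ℕ) (s : G), {x | (x ∈ B n ∨ s • x ∈ B n) ∧ ¬ r' x (s • x)}
        = {x | (x ∈ B n ∨ s • x ∈ B n) ∧ ¬ r n x (s • x)} := by
      intro n s
      ext x
      refine and_congr_right fun hx => not_congr ?_
      rcases hx with hx | hx
      · exact hr' n x hx _
      · rw [r'.comm', (r n).comm']
        exact hr' n _ hx _
    have hU : ∀ s : G, {x | (x ∈ ⋃ n, B n ∨ s • x ∈ ⋃ n, B n) ∧ ¬ r' x (s • x)}
        = ⋃ n, {x | (x ∈ B n ∨ s • x ∈ B n) ∧ ¬ r' x (s • x)} := by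
      intro s
      ext x
      simp only [Set.mem_iUnion, Set.mem_ofPred_eq, ← exists_or, exists_and_right]
    have hlim : Tendsto (fun n => ∑ s ∈ S, μ {x | (x ∈ B n ∨ s • x ∈ B n) ∧ ¬ r' x (s • x)}) atTop
        (𝓝 (∑ s ∈ S, μ {x | (x ∈ ⋃ n, B n ∨ s • x ∈ ⋃ n, B n) ∧ ¬ r' x (s • x)})) := by
      refine tendsto_finsetSum _ fun s _ => ?_
      rw [hU]
      refine tendsto_measure_iUnion_atTop fun m n hmn x hx => ⟨?_, hx.2⟩
      exact hx.1.imp (fun h => hBmono hmn h) fun h => hBmono hmn h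
    refine le_of_tendsto hlim (Eventually.of_forall fun n => ?_)
    simp_rw [hcut]
    exact (h n).cut_le.trans (by gcongr; exact Set.subset_iUnion B n)

end IsPartialTiling

end Tiling

/-! ### Extending a tiling by traces of Følner tiles. -/

section Extension

variable {G X : Type*} [Group G] [MulAction G X]

open scoped Classical in
/-- The number of pairs of `f ∈ F` and an oriented generator that moves `f` out of `F`. -/
noncomputable def exitCount (S F : Finset G) : ℕ :=
  ∑ s ∈ S, ((F.filter fun f => s * f ∉ F).card + (F.filter fun f => s⁻¹ * f ∉ F).card)

/-- Displacement is twice the number of exits, so tolerance `ε / (|S| + 1)` on `S ∪ S⁻¹` costs at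
most `|S| / (|S| + 1) * ε * |F|` in total. The strict inequality is what the averaging over base
points contradicts. -/
theorem AmenableGroup.exists_exitCount_lt (hG : AmenableGroup G) (S : Finset G) {ε : ℝ}
    (hε : 0 < ε) : ∃ F : Finset G, (exitCount S F : ℝ) < ε * F.card := by
  classical
  obtain ⟨F, hF, hFE⟩ := hG (S ∪ S.image fun s => s⁻¹) (ε / (S.card + 1)) (by positivity)
  have hFpos : (0 : ℝ) < F.card := by exact_mod_cast hF.card_pos
  refine ⟨F, ?_⟩
  have hterm : ∀ g ∈ S ∪ S.image fun s => s⁻¹,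
      2 * ((F.filter fun f => g * f ∉ F).card : ℝ) ≤ ε / (S.card + 1) * F.card := by
    intro g hg
    have := hFE g hg
    rw [card_symmDiff_smul_eq] at this
    exact_mod_cast this
  have hsum : (exitCount S F : ℝ) ≤ ∑ _s ∈ S, ε / (S.card + 1) * F.card := by
    unfold exitCount
    push_cast
    refine Finset.sum_le_sum fun s hs => ?_
    have h1 := hterm s (Finset.mem_union_left _ hs)
    have h2 := hterm s⁻¹ (Finset.mem_union_right _ (Finset.mem_image_of_mem _ hs))
    linarith
  refine hsum.trans_lt ?_
  rw [Finset.sum_const, nsmul_eq_mul]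
  have : (S.card : ℝ) * (ε / (S.card + 1) * F.card) = S.card / (S.card + 1) * (ε * F.card) := by
    ring
  rw [this]
  refine mul_lt_of_lt_one_left (by positivity) ?_
  rw [div_lt_one (by positivity)]
  linarith

variable [MeasurableSpace X]

open scoped Classical in
/-- If few elements of `F` leave `F` under the generators, then in a non-null set `A` one finds a
non-null set of base points whose `F`-translates are disjoint and whose traces on `A` have few
outgoing edges. -/
theorem exists_tile_base [StandardBorelSpace X] [MeasurableConstSMul G X] {μ : Measure X}
    [IsFiniteMeasure μ] [SMulInvariantMeasure G X μ] (hfree : EssentiallyFree G μ) (S F : Finset G)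
    {ε : ℝ≥0∞} (hF : (exitCount S F : ℝ≥0∞) < ε * F.card) {A : Set X} (hA : MeasurableSet A)
    (hA0 : μ A ≠ 0) :
    ∃ C : Set X, MeasurableSet C ∧
      (∀ f ∈ F, ∀ f' ∈ F, ∀ c ∈ C, ∀ c' ∈ C, f • c = f' • c' → f = f') ∧
      ∑ f ∈ F, μ (C ∩ (f • ·) ⁻¹' A) ≠ 0 ∧
      ∑ s ∈ S, (∑ f ∈ F with s * f ∉ F, μ (C ∩ (f • ·) ⁻¹' A) +
        ∑ f ∈ F with s⁻¹ * f ∉ F, μ (C ∩ (f • ·) ⁻¹' A)) ≤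
          ε * ∑ f ∈ F, μ (C ∩ (f • ·) ⁻¹' A) := by
  set w : G → X → ℝ≥0∞ := fun f => ((f • ·) ⁻¹' A).indicator 1 with hw
  have hAf : ∀ f : G, MeasurableSet ((f • ·) ⁻¹' A : Set X) := fun f => measurable_const_smul f hA
  have hwm : ∀ f, Measurable (w f) := fun f => measurable_one.indicator (hAf f)
  -- For the tile based at `x`, `h` counts the `f ∈ F` that land in `A`, and `e` counts the exits
  -- from `F` at those `f`.
  set h : X → ℝ≥0∞ := fun x => ∑ f ∈ F, w f x with hh
  set e : X → ℝ≥0∞ := fun x => ∑ s ∈ S, (∑ f ∈ F with s * f ∉ F, w f x +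
    ∑ f ∈ F with s⁻¹ * f ∉ F, w f x) with he
  have hhm : Measurable h := Finset.measurable_fun_sum _ fun f _ => hwm f
  have hem : Measurable e := Finset.measurable_fun_sum _ fun s _ =>
    (Finset.measurable_fun_sum _ fun f _ => hwm f).add
      (Finset.measurable_fun_sum _ fun f _ => hwm f)
  have hwint : ∀ (C : Set X) (f : G), ∫⁻ x in C, w f x ∂μ = μ (C ∩ (f • ·) ⁻¹' A) := by
    intro C f
    rw [hw, lintegral_indicator_one (hAf f), Measure.restrict_apply (hAf f), Set.inter_comm]
  have hhint : ∀ C : Set X, ∫⁻ x in C, h x ∂μ = ∑ f ∈ F, μ (C ∩ (f • ·) ⁻¹' A) := by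
    intro C
    rw [hh, lintegral_finsetSum _ fun f _ => hwm f]
    exact Finset.sum_congr rfl fun f _ => hwint C f
  have heint : ∀ C : Set X, ∫⁻ x in C, e x ∂μ = ∑ s ∈ S,
      (∑ f ∈ F with s * f ∉ F, μ (C ∩ (f • ·) ⁻¹' A) +
        ∑ f ∈ F with s⁻¹ * f ∉ F, μ (C ∩ (f • ·) ⁻¹' A)) := by
    intro C
    rw [he, lintegral_finsetSum _ fun s _ => Measurable.fun_add
      (Finset.measurable_fun_sum _ fun f _ => hwm f) (Finset.measurable_fun_sum _ fun f _ => hwm f)]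
    refine Finset.sum_congr rfl fun s _ => ?_
    rw [lintegral_add_left (Finset.measurable_fun_sum _ fun f _ => hwm f),
      lintegral_finsetSum _ fun f _ => hwm f, lintegral_finsetSum _ fun f _ => hwm f]
    simp_rw [hwint]
  have hμA : ∀ f : G, μ ((f • ·) ⁻¹' A) = μ A := fun f => measure_preimage_smul μ f A
  set P : Set X := {x | e x ≤ ε * h x} ∩ {x | h x = 0}ᶜ with hPdef
  have hP : MeasurableSet P :=
    (measurableSet_le hem (measurable_const.mul hhm)).inter
      (hhm (measurableSet_singleton 0)).compl
  -- Otherwise `ε * h ≤ e` almost everywhere. All translates of `A` have measure `μ A`, so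
  -- integrating and cancelling `μ A` gives `ε * |F| ≤ exitCount S F`.
  have hP0 : μ P ≠ 0 := by
    intro hP0
    have hae : ∀ᵐ x ∂μ, ε * h x ≤ e x := by
      filter_upwards [measure_eq_zero_iff_ae_notMem.1 hP0] with x hx
      by_cases hx0 : h x = 0
      · simp [hx0]
      · by_contra hlt
        exact hx ⟨(not_le.1 hlt).le, hx0⟩
    have h1 := lintegral_mono_ae hae
    rw [lintegral_const_mul _ hhm, ← setLIntegral_univ h, ← setLIntegral_univ e, hhint, heint] at h1
    simp only [Set.univ_inter, hμA, Finset.sum_const, nsmul_eq_mul, ← add_mul] at h1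
    rw [← Finset.sum_mul, ← mul_assoc] at h1
    have h2 := (ENNReal.mul_le_mul_iff_left hA0 (measure_ne_top μ A)).1 h1
    refine absurd hF (not_lt.2 ?_)
    unfold exitCount
    push_cast
    exact h2
  obtain ⟨C, hCP, hC, hC0, hCD⟩ := exists_subset_forall_smul_notMem hfree
    (((F ×ˢ F).image fun p => p.2⁻¹ * p.1).erase 1) (Finset.notMem_erase _ _) hP hP0
  refine ⟨C, hC, ?_, ?_, ?_⟩
  · intro f hf f' hf' c hc c' hc' heq
    by_contra hne
    refine hCD (f'⁻¹ * f) ?_ c hc ?_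
    · refine Finset.mem_erase.2 ⟨fun h1 => hne (inv_mul_eq_one.1 h1).symm, ?_⟩
      exact Finset.mem_image.2 ⟨(f, f'), Finset.mk_mem_product hf hf', rfl⟩
    · rwa [mul_smul, heq, inv_smul_smul]
  · rw [← hhint, Ne, lintegral_eq_zero_iff hhm]
    intro hz
    rw [EventuallyEq, ae_restrict_iff' hC] at hz
    refine hC0 (measure_eq_zero_iff_ae_notMem.2 ?_)
    filter_upwards [hz] with x hx hxC
    exact (hCP hxC).2 (hx hxC)
  · rw [← hhint, ← heint, ← lintegral_const_mul _ hhm]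
    exact setLIntegral_mono (measurable_const.mul hhm) fun x hx => (hCP hx).1

/-- The relation `r`, trivial on `A`, with the traces on `A` of the disjoint translates
`F • c`, `c ∈ C`, added as new classes. -/
def addTiles (r : Setoid X) (A : Set X) (F : Finset G) (C : Set X)
    (hr : ∀ x y, x ∈ A → r x y → x = y)
    (hdisj : ∀ f ∈ F, ∀ f' ∈ F, ∀ c ∈ C, ∀ c' ∈ C, f • c = f' • c' → f = f') : Setoid X where
  r x y := r x y ∨ (x ∈ A ∧ y ∈ A ∧ ∃ f ∈ F, ∃ f' ∈ F, f⁻¹ • x ∈ C ∧ f'⁻¹ • y = f⁻¹ • x)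
  iseqv :=
    { refl := fun x => Or.inl (r.refl' x)
      symm := by
        rintro x y (h | ⟨hx, hy, f, hf, f', hf', hc, heq⟩)
        · exact Or.inl (r.symm' h)
        · exact Or.inr ⟨hy, hx, f', hf', f, hf, heq ▸ hc, heq.symm⟩
      -- In the mixed cases the middle point lies in `A`, where `r` is equality. When both steps lie
      -- in tiles, disjointness of the translates identifies the two tiles.
      trans := by
        rintro x y z (h | ⟨hx, hy, f, hf, f', hf', hc, heq⟩)
          (h' | ⟨hy', hz, k, hk, k', hk', hc', heq'⟩)
        · exact Or.inl (r.trans' h h')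
        · obtain rfl := hr y x hy' (r.symm' h)
          exact Or.inr ⟨hy', hz, k, hk, k', hk', hc', heq'⟩
        · obtain rfl := hr y z hy h'
          exact Or.inr ⟨hx, hy, f, hf, f', hf', hc, heq⟩
        · have hfk : f' = k := hdisj f' hf' k hk _ (heq ▸ hc) _ hc' (by simp)
          subst hfk
          exact Or.inr ⟨hx, hz, f, hf, k', hk', hc, heq'.trans heq⟩ }

/-- A partial tiling of an essentially free action of an amenable group that misses a non-null set
can be extended non-trivially. -/
theorem IsPartialTiling.exists_extends [StandardBorelSpace X] [MeasurableConstSMul G X]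
    {μ : Measure X} [IsFiniteMeasure μ] [SMulInvariantMeasure G X μ] (hfree : EssentiallyFree G μ)
    (hG : AmenableGroup G) {S : Finset G} {ε : ℝ} (hε : 0 < ε) {r : Setoid X} {B : Set X}
    (h : IsPartialTiling S μ (ENNReal.ofReal ε) r B) (hB : μ Bᶜ ≠ 0) :
    ∃ r' B', IsPartialTiling S μ (ENNReal.ofReal ε) r' B' ∧ TilingExtends (r, B) (r', B') ∧
      μ B < μ B' := by
  classical
  obtain ⟨F, hF⟩ := hG.exists_exitCount_lt S hε
  have hF' : (exitCount S F : ℝ≥0∞) < ENNReal.ofReal ε * F.card := by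
    rw [← ENNReal.ofReal_natCast, ← ENNReal.ofReal_natCast, ← ENNReal.ofReal_mul hε.le]
    exact (ENNReal.ofReal_lt_ofReal_iff_of_nonneg (by positivity)).2 hF
  have hA := h.measurableSet.compl
  obtain ⟨C, hC, hdisj, hpos, hcut⟩ := exists_tile_base hfree S F hF' hA hB
  have hrA : ∀ x y, x ∈ Bᶜ → r x y → x = y := fun x y hx => h.eq_of_notMem x y hx
  set r' := addTiles r Bᶜ F C hrA hdisj with hr'def
  have hr' : ∀ x y, r' x y ↔ r x y ∨ (x ∈ Bᶜ ∧ y ∈ Bᶜ ∧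
    ∃ f ∈ F, ∃ f' ∈ F, f⁻¹ • x ∈ C ∧ f'⁻¹ • y = f⁻¹ • x) := fun x y => Iff.rfl
  -- The part of the translate of `C` by `f` lying in `A = Bᶜ`; these parts are disjoint and make up
  -- the new domain.
  set T : G → Set X := fun f => Bᶜ ∩ (f⁻¹ • ·) ⁻¹' C with hT
  have hTm : ∀ f, MeasurableSet (T f) := fun f => hA.inter (measurable_const_smul _ hC)
  have hTμ : ∀ f, μ (T f) = μ (C ∩ (f • ·) ⁻¹' Bᶜ) := by
    intro f
    rw [← measure_preimage_smul μ f (T f)]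
    congr 1
    ext x
    simp [hT, and_comm]
  set N : Set X := ⋃ f ∈ F, T f with hN
  have hNm : MeasurableSet N := F.measurableSet_biUnion fun f _ => hTm f
  have hNB : Disjoint B N := by
    rw [Set.disjoint_left]
    intro x hx hxN
    obtain ⟨f, hf, hxf⟩ := Set.mem_iUnion₂.1 hxN
    exact hxf.1 hx
  have hNμ : μ N = ∑ f ∈ F, μ (C ∩ (f • ·) ⁻¹' Bᶜ) := by
    rw [hN, measure_biUnion_finset _ fun f _ => hTm f]
    · exact Finset.sum_congr rfl fun f _ => hTμ f
    · intro f hf f' hf' hne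
      refine Set.disjoint_left.2 fun x hx hx' => hne ?_
      exact hdisj f hf f' hf' _ hx.2 _ hx'.2 (by simp)
  have hold : ∀ x ∈ B, ∀ y, r' x y ↔ r x y := fun x hx y =>
    ⟨fun hxy => hxy.elim id fun hxy => absurd hx hxy.1, Or.inl⟩
  have hBN : μ (B ∪ N) = μ B + μ N := measure_union hNB hNm
  refine ⟨r', B ∪ N, ⟨?_, ?_, ?_, h.measurableSet.union hNm, ?_, ?_⟩,
    ⟨Set.subset_union_left, hold⟩, ?_⟩
  · rintro x y (hxy | ⟨-, -, f, hf, f', hf', -, heq⟩)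
    · exact h.le_orbitRel hxy
    · refine MulAction.mem_orbit_iff.2 ⟨f * f'⁻¹, ?_⟩
      rw [mul_smul, heq, smul_inv_smul]
  · have : {p : X × X | r' p.1 p.2} = {p : X × X | r p.1 p.2} ∪
        (Prod.fst ⁻¹' Bᶜ ∩ (Prod.snd ⁻¹' Bᶜ ∩ ⋃ f ∈ F, ⋃ f' ∈ F,
          (Prod.fst ⁻¹' ((f⁻¹ • ·) ⁻¹' C) ∩ {p : X × X | f'⁻¹ • p.2 = f⁻¹ • p.1}))) := by
      ext p
      simp only [Set.mem_union, Set.mem_inter_iff, Set.mem_iUnion, Set.mem_preimage,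
        Set.mem_ofPred_eq, hr', exists_prop]
    rw [this]
    refine h.measurableSet_rel.union ((measurable_fst hA).inter ((measurable_snd hA).inter
      (F.measurableSet_biUnion fun f _ => F.measurableSet_biUnion fun f' _ => ?_)))
    exact (measurable_fst (measurable_const_smul _ hC)).inter
      (measurableSet_eq_fun (measurable_snd.const_smul _) (measurable_fst.const_smul _))
  · intro x
    refine ((h.finite_class x).union
      ((F ×ˢ F).image fun p => p.2 • p.1⁻¹ • x).finite_toSet).subset ?_
    rintro y (hxy | ⟨-, -, f, hf, f', hf', -, heq⟩)
    · exact Or.inl hxy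
    · refine Or.inr ?_
      rw [Finset.mem_coe, Finset.mem_image]
      exact ⟨(f, f'), Finset.mk_mem_product hf hf', by simp only; rw [← heq, smul_inv_smul]⟩
  · rintro x y hx (hxy | ⟨hxB, -, f, hf, f', hf', hc, heq⟩)
    · exact h.eq_of_notMem x y (fun hx' => hx (Or.inl hx')) hxy
    · exact (hx (Or.inr (Set.mem_iUnion₂.2 ⟨f, hf, hxB, hc⟩))).elim
  -- A cut edge touching `B` was cut before and is already charged. Any other has both ends in `A`;
  -- if one end is `f • c`, the other is `(s * f) • c` or `(s⁻¹ * f) • c`, so being cut forces an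
  -- exit from `F`.
  · have hsub : ∀ s ∈ S, μ {x | (x ∈ B ∪ N ∨ s • x ∈ B ∪ N) ∧ ¬ r' x (s • x)} ≤
        μ {x | (x ∈ B ∨ s • x ∈ B) ∧ ¬ r x (s • x)} +
          (∑ f ∈ F with s * f ∉ F, μ (C ∩ (f • ·) ⁻¹' Bᶜ) +
            ∑ f ∈ F with s⁻¹ * f ∉ F, μ (C ∩ (f • ·) ⁻¹' Bᶜ)) := by
      intro s _
      have hcover : {x | (x ∈ B ∪ N ∨ s • x ∈ B ∪ N) ∧ ¬ r' x (s • x)} ⊆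
          {x | (x ∈ B ∨ s • x ∈ B) ∧ ¬ r x (s • x)} ∪
            ((⋃ f ∈ F.filter fun f => s * f ∉ F, T f) ∪
              ⋃ f ∈ F.filter fun f => s⁻¹ * f ∉ F, (s • ·) ⁻¹' T f) := by
        rintro x ⟨hx, hnr⟩
        by_cases hxB : x ∈ B ∨ s • x ∈ B
        · exact Or.inl ⟨hxB, fun hxr => hnr (Or.inl hxr)⟩
        obtain ⟨hxB, hsB⟩ := not_or.1 hxB
        refine Or.inr ?_
        rcases hx with (hx | hx) | (hx | hx)
        · exact absurd hx hxB
        · obtain ⟨f, hf, hxf⟩ := Set.mem_iUnion₂.1 hx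
          refine Or.inl (Set.mem_biUnion (Finset.mem_coe.2 (Finset.mem_filter.2 ⟨hf, ?_⟩)) hxf)
          intro hsf
          refine hnr (Or.inr ⟨hxB, hsB, f, hf, s * f, hsf, hxf.2, ?_⟩)
          rw [smul_smul]
          simp
        · exact absurd hx hsB
        · obtain ⟨f, hf, hxf⟩ := Set.mem_iUnion₂.1 hx
          refine Or.inr (Set.mem_biUnion (Finset.mem_coe.2 (Finset.mem_filter.2 ⟨hf, ?_⟩)) hxf)
          intro hsf
          have hsx : (s⁻¹ * f)⁻¹ • x = f⁻¹ • s • x := by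
            rw [smul_smul]
            simp
          exact hnr (Or.inr ⟨hxB, hsB, s⁻¹ * f, hsf, f, hf, hsx ▸ hxf.2, hsx.symm⟩)
      refine (measure_mono hcover).trans ((measure_union_le _ _).trans ?_)
      gcongr
      refine (measure_union_le _ _).trans ?_
      gcongr
      · refine (measure_biUnion_finset_le _ _).trans (le_of_eq ?_)
        exact Finset.sum_congr rfl fun f _ => hTμ f
      · refine (measure_biUnion_finset_le _ _).trans (le_of_eq ?_)
        refine Finset.sum_congr rfl fun f _ => ?_
        rw [measure_preimage_smul, hTμ]
    refine (Finset.sum_le_sum hsub).trans ?_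
    rw [Finset.sum_add_distrib, hBN, mul_add, hNμ]
    exact add_le_add h.cut_le hcut
  · rw [hBN]
    exact ENNReal.lt_add_right (measure_ne_top μ B) (hNμ ▸ hpos)

/-- Essentially free actions of amenable groups have partial tilings of full measure. -/
theorem AmenableGroup.exists_isPartialTiling [StandardBorelSpace X] [MeasurableConstSMul G X]
    {μ : Measure X} [IsFiniteMeasure μ] [SMulInvariantMeasure G X μ] (hG : AmenableGroup G)
    (hfree : EssentiallyFree G μ) (S : Finset G) {ε : ℝ} (hε : 0 < ε) :
    ∃ r B, IsPartialTiling S μ (ENNReal.ofReal ε) r B ∧ μ Bᶜ = 0 := by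
  let α := {p : Setoid X × Set X // IsPartialTiling S μ (ENNReal.ofReal ε) p.1 p.2}
  have : Nonempty α := ⟨⟨(⊥, ∅), IsPartialTiling.bot⟩⟩
  -- Maximize `μ B` along extensions; using only sequences keeps the unions measurable.
  obtain ⟨⟨⟨r, B⟩, h⟩, hmax⟩ := exists_forall_rel_le (α := α)
    (fun p q => TilingExtends p.1 q.1) (fun p => ⟨subset_rfl, fun _ _ _ => Iff.rfl⟩)
    (fun p q s hpq hqs => ⟨hpq.1.trans hqs.1, fun x hx y =>
      (hqs.2 x (hpq.1 hx) y).trans (hpq.2 x hx y)⟩)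
    (fun p => μ.real p.1.2) (fun p q hpq => measureReal_mono hpq.1)
    ⟨μ.real Set.univ, by rintro _ ⟨p, rfl⟩; exact measureReal_mono (Set.subset_univ _)⟩
    (fun u hu => by
      obtain ⟨r', B', h', hext⟩ := IsPartialTiling.exists_extends_seq
        (fun n => (u n).1.1) (fun n => (u n).1.2) (fun n => (u n).2) hu
      exact ⟨⟨(r', B'), h'⟩, hext⟩)
  refine ⟨r, B, h, ?_⟩
  by_contra hB
  obtain ⟨r', B', h', hext, hlt⟩ := h.exists_extends hfree hG hε hB
  refine absurd (hmax ⟨(r', B'), h'⟩ hext) (not_le.2 ?_)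
  exact (ENNReal.toReal_lt_toReal (measure_ne_top μ _) (measure_ne_top μ _)).2 hlt

end Extension

/-! ### Truncation to bounded classes and the converse. -/

section Truncation

variable {G X : Type*} [Group G] [MulAction G X]

/-- The relation that keeps the classes of `r` with at most `n` elements and splits the others into
points. -/
def truncateClasses (r : Setoid X) (n : ℕ) : Setoid X where
  r x y := x = y ∨ (r x y ∧ {z | r x z}.encard ≤ n)
  iseqv :=
    have hclass : ∀ {x y}, r x y → {z | r x z} = {z | r y z} := fun h =>
      Set.ext fun _ => ⟨fun h' => r.trans' (r.symm' h) h', fun h' => r.trans' h h'⟩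
    { refl := fun x => Or.inl rfl
      symm := by
        rintro x y (rfl | ⟨h, hn⟩)
        · exact Or.inl rfl
        · exact Or.inr ⟨r.symm' h, hclass h ▸ hn⟩
      trans := by
        rintro x y z (rfl | ⟨h, hn⟩) (rfl | ⟨h', hn'⟩)
        · exact Or.inl rfl
        · exact Or.inr ⟨h', hn'⟩
        · exact Or.inr ⟨h, hn⟩
        · exact Or.inr ⟨r.trans' h h', hn⟩ }

variable [MeasurableSpace X]

/-- A class has more than `n` points exactly when some `n + 1` group elements carry `x` to distinct
points of it. Countability of `G` leaves countably many such finite sets to test. -/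
theorem measurableSet_encard_class_le [Countable G] [StandardBorelSpace X]
    [MeasurableConstSMul G X] {r : Setoid X} (hle : r ≤ MulAction.orbitRel G X)
    (hr : MeasurableSet {p : X × X | r p.1 p.2}) (n : ℕ) :
    MeasurableSet {x | {z | r x z}.encard ≤ n} := by
  classical
  have key : {x | {z | r x z}.encard ≤ n}ᶜ = ⋃ T ∈ {T : Finset G | T.card = n + 1},
      ((⋂ g ∈ T, {x | r x (g • x)}) ∩ ⋂ g ∈ T, ⋂ k ∈ T.erase g, {x | g • x = k • x}ᶜ) := by
    ext x
    simp only [Set.mem_compl_iff, Set.mem_ofPred_eq, not_le, Set.mem_iUnion, Set.mem_inter_iff,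
      Set.mem_iInter, exists_prop, Finset.mem_erase]
    constructor
    · intro hlt
      have hlt' : ((n + 1 : ℕ) : ℕ∞) ≤ {z | r x z}.encard := by
        push_cast
        exact Order.add_one_le_of_lt hlt
      obtain ⟨t, ht, htc⟩ := Set.exists_subset_encard_eq hlt'
      have htfin : t.Finite := Set.finite_of_encard_eq_coe htc
      have horb : ∀ z : X, ∃ g : G, z ∈ t → g • x = z := by
        intro z
        by_cases hz : z ∈ t
        · obtain ⟨g, hg⟩ := hle (r.symm' (ht hz))
          exact ⟨g, fun _ => hg⟩
        · exact ⟨1, fun h => absurd h hz⟩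
      choose γ hγ using horb
      have hinj : Set.InjOn γ htfin.toFinset := by
        intro z hz z' hz' heq
        rw [Set.Finite.coe_toFinset] at hz hz'
        rw [← hγ z hz, ← hγ z' hz', heq]
      refine ⟨htfin.toFinset.image γ, ?_, ?_, ?_⟩
      · rw [Finset.card_image_of_injOn hinj]
        rw [htfin.encard_eq_coe_toFinset_card] at htc
        exact_mod_cast htc
      · intro g hg
        obtain ⟨z, hz, rfl⟩ := Finset.mem_image.1 hg
        rw [Set.Finite.mem_toFinset] at hz
        rw [hγ z hz]
        exact ht hz
      · intro g hg k hk heq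
        obtain ⟨z, hz, rfl⟩ := Finset.mem_image.1 hg
        obtain ⟨z', hz', rfl⟩ := Finset.mem_image.1 hk.2
        rw [Set.Finite.mem_toFinset] at hz hz'
        rw [hγ z hz, hγ z' hz'] at heq
        exact hk.1 (heq ▸ rfl)
    · rintro ⟨T, hT, hrT, hinj⟩
      have hsub : ((T.image fun g => g • x : Finset X) : Set X) ⊆ {z | r x z} := by
        intro z hz
        obtain ⟨g, hg, rfl⟩ := Finset.mem_image.1 (Finset.mem_coe.1 hz)
        exact hrT g hg
      have hcard : (T.image fun g => g • x).card = n + 1 := by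
        rw [Finset.card_image_of_injOn, hT]
        intro g hg k hk heq
        by_contra hne
        exact hinj g hg k ⟨fun h => hne h.symm, hk⟩ heq
      have := Set.encard_le_encard hsub
      rw [Set.encard_coe_eq_coe_finsetCard, hcard] at this
      refine lt_of_lt_of_le ?_ this
      exact_mod_cast Nat.lt_succ_self n
  rw [← MeasurableSet.compl_iff, key]
  refine .biUnion (Set.to_countable _) fun T _ => .inter ?_ ?_
  · exact T.measurableSet_biInter fun g _ => measurableSet_rel_smul hr g
  · exact T.measurableSet_biInter fun g _ => (T.erase g).measurableSet_biInter fun k _ =>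
      (measurableSet_eq_fun (measurable_const_smul g) (measurable_const_smul k)).compl

theorem isBoundedSubrelation_truncateClasses [Countable G] [StandardBorelSpace X]
    [MeasurableConstSMul G X] {r : Setoid X} (hle : r ≤ MulAction.orbitRel G X)
    (hr : MeasurableSet {p : X × X | r p.1 p.2}) {n : ℕ} (hn : 1 ≤ n) :
    IsBoundedSubrelation G n (truncateClasses r n) where
  le_orbitRel := by
    rintro x y (rfl | ⟨h, -⟩)
    · exact (MulAction.orbitRel G X).refl' x
    · exact hle h
  measurableSet := by
    have : {p : X × X | truncateClasses r n p.1 p.2} = {p : X × X | p.1 = p.2} ∪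
        ({p : X × X | r p.1 p.2} ∩ Prod.fst ⁻¹' {x | {z | r x z}.encard ≤ n}) := rfl
    rw [this]
    exact (measurableSet_eq_fun measurable_fst measurable_snd).union
      (hr.inter (measurable_fst (measurableSet_encard_class_le hle hr n)))
  encard_le x := by
    by_cases h : {z | r x z}.encard ≤ n
    · refine (Set.encard_le_encard ?_).trans h
      rintro y (rfl | ⟨hy, -⟩)
      · exact r.refl' x
      · exact hy
    · have hsub : {y | truncateClasses r n x y} ⊆ {x} := by
        rintro y (rfl | ⟨-, hy⟩)
        · rfl
        · exact absurd hy h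
      refine (Set.encard_le_encard hsub).trans ?_
      rw [Set.encard_singleton]
      exact_mod_cast hn

/-- The isoperimetric profile of an essentially free action of an amenable group tends to zero. -/
theorem AmenableGroup.tendsto_actionProfile [StandardBorelSpace X] [MeasurableConstSMul G X]
    {S : Set G} (hSfin : S.Finite) (hSgen : Subgroup.closure S = ⊤)
    (μ : Measure X) [IsProbabilityMeasure μ] [SMulInvariantMeasure G X μ]
    (hfree : EssentiallyFree G μ) (hG : AmenableGroup G) :
    Tendsto (fun n : ℕ => actionProfile S μ n) atTop (𝓝 0) := by
  have := countable_of_closure_eq_top hSfin hSgen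
  refine ENNReal.tendsto_nhds_zero.2 fun η hη => ?_
  obtain ⟨ε, hε0, hεη⟩ : ∃ ε : ℝ, 0 < ε ∧ ENNReal.ofReal ε < η := by
    obtain ⟨ε, -, hε0, hεη⟩ := ENNReal.lt_iff_exists_real_btwn.1 hη
    exact ⟨ε, ENNReal.ofReal_pos.1 hε0, hεη⟩
  obtain ⟨r, B, h, hB⟩ := hG.exists_isPartialTiling hfree hSfin.toFinset hε0
  have hbound : μ (relBoundary S r) ≤ ENNReal.ofReal ε := by
    have hsub : relBoundary S r ⊆ Bᶜ ∪ ⋃ s ∈ hSfin.toFinset,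
        {x | (x ∈ B ∨ s • x ∈ B) ∧ ¬ r x (s • x)} := by
      rintro x ⟨s, hs, hx⟩
      by_cases hxB : x ∈ B
      · exact Or.inr (Set.mem_biUnion (x := s) (by simpa using hs) ⟨Or.inl hxB, hx⟩)
      · exact Or.inl hxB
    calc μ (relBoundary S r) ≤ _ := measure_mono hsub
      _ ≤ _ := measure_union_le _ _
      _ ≤ 0 + ENNReal.ofReal ε * μ B := by
          gcongr
          · exact hB.le
          · exact (measure_biUnion_finset_le _ _).trans h.cut_le
      _ ≤ ENNReal.ofReal ε := by
          rw [zero_add]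
          exact mul_le_of_le_one_right' prob_le_one
  set Q : ℕ → Set X := fun n => {x | {z | r x z}.encard ≤ n} with hQ
  have hQm : ∀ n, MeasurableSet (Q n) := fun n =>
    measurableSet_encard_class_le h.le_orbitRel h.measurableSet_rel n
  -- Truncation adds boundary only at points whose class exceeds `n`. Since all classes are finite,
  -- these sets decrease to the empty set.
  have hlim : Tendsto (fun n => μ (Q n)ᶜ) atTop (𝓝 0) := by
    have hanti : Antitone fun n => (Q n)ᶜ := fun m n hmn =>
      Set.compl_subset_compl.2 fun x hx => le_trans (α := ℕ∞) hx (Nat.cast_le.2 hmn)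
    have hempty : ⋂ n, (Q n)ᶜ = ∅ := by
      rw [← Set.compl_iUnion, Set.compl_empty_iff]
      refine Set.eq_univ_of_forall fun x => Set.mem_iUnion.2 ⟨(h.finite_class x).toFinset.card, ?_⟩
      exact (h.finite_class x).encard_eq_coe_toFinset_card.le
    have := tendsto_measure_iInter_atTop (μ := μ) (fun n => (hQm n).compl.nullMeasurableSet) hanti
      ⟨0, measure_ne_top μ _⟩
    rwa [hempty, measure_empty] at this
  have hsum : Tendsto (fun n => ENNReal.ofReal ε + μ (Q n)ᶜ) atTop (𝓝 (ENNReal.ofReal ε)) := by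
    simpa using tendsto_const_nhds.add hlim
  filter_upwards [hsum.eventually_lt_const hεη, eventually_ge_atTop 1] with n hn hn1
  refine (iInf₂_le (truncateClasses r n)
    (isBoundedSubrelation_truncateClasses h.le_orbitRel h.measurableSet_rel hn1)).trans
      (le_trans ?_ hn.le)
  have hsub : relBoundary S (truncateClasses r n) ⊆ relBoundary S r ∪ (Q n)ᶜ := by
    rintro x ⟨s, hs, hx⟩
    by_cases hxQ : x ∈ Q n
    · exact Or.inl ⟨s, hs, fun hr => hx (Or.inr ⟨hr, hxQ⟩)⟩
    · exact Or.inr hxQ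
  exact (measure_mono hsub).trans ((measure_union_le _ _).trans (by gcongr))

end Truncation

theorem theorem1p3 {G X : Type*} [Group G] [MulAction G X]
    [MeasurableSpace X] [StandardBorelSpace X] [MeasurableConstSMul G X]
    (S : Set G) (hSfin : S.Finite) (hSsymm : ∀ s ∈ S, s⁻¹ ∈ S) (hSgen : Subgroup.closure S = ⊤)
    (μ : Measure X) [IsProbabilityMeasure μ] [SMulInvariantMeasure G X μ]
    (hfree : EssentiallyFree G μ) :
    (Tendsto (fun n : ℕ => actionProfile S μ n) atTop (𝓝 0) → AmenableGroup G) ∧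
    (ErgodicSMul G X μ → AmenableGroup G →
      Tendsto (fun n : ℕ => actionProfile S μ n) atTop (𝓝 0)) := by
  exact ⟨amenableGroup_of_tendsto_actionProfile hSfin hSgen μ hfree,
    fun _ hG => hG.tendsto_actionProfile hSfin hSgen μ hfree⟩
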